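/- Let $K$ be a compact Hausdorff space, let $X=C(K)$ be the Banach space of real-valued continuous functions on $K$ with the supremum norm, and let $Y$ be a real Banach space. Suppose that at least one of the following holds: - $Y^*$ has the point of $w^*$-to-norm continuity property ($w^*$-PCP): for every nonempty bounded set $A\subset Y^*$ and every $\delta>0$ there is a $w^*$-open set $V\subset Y^*$ such that $A\cap V$ is nonempty and has norm diameter less than $\delta$ (in particular this covers the case that $Y$ is an Asplund space, i.e. every continuous convex function on a nonempty open convex subset $U$ of $Y$ is Fréchet differentiable at every point of a dense $G_\delta$ subset of $U$); - $Y$ is separable. Let $\varepsilon\ge 0$ and let $f:X\to Y$ be a standard $\varepsilon$-isometry, that is, a map with $f(0)=0$ and $$\bigl|\,\|f(x)-f(y)\|-\|x-y\|\,\bigr|\le\varepsilon\qquad\text{for all }x,y\in X .$$ Then there exist a dense $G_\delta$ subset $\Omega$ of $K$ and a bounded linear operator $T:Y\to C(\Omega)$, where $C(\Omega)$ is the space of bounded real-valued continuous functions on $\Omega$ with the supremum norm, such that $$\bigl\|T(f(x))-x|_\Omega\bigr\|=\sup_{t\in\Omega}\bigl|T(f(x))(t)-x(t)\bigr|\le 4\varepsilon\qquad\text{for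 all }x\in X .$$ -/

import Mathlib

/-- A standard `ε`-isometry between real normed spaces: `f 0 = 0` and
`|‖f x - f y‖ - ‖x - y‖| ≤ ε` for all `x`, `y`. -/
def IsStandardEpsIsometry {X Y : Type*} [NormedAddCommGroup X] [NormedAddCommGroup Y]
    (ε : ℝ) (f : X → Y) : Prop :=
  f 0 = 0 ∧ ∀ x y : X, |‖f x - f y‖ - ‖x - y‖| ≤ ε

/-- The dual `Y*` has the point of weak-star to norm continuity property: every nonempty bounded
subset `A` of `Y*` has nonempty relatively weak-star open subsets of arbitrarily small norm
diameter. -/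
def DualHasWeakStarPCP (Y : Type*) [NormedAddCommGroup Y] [NormedSpace ℝ Y] : Prop :=
  ∀ A : Set (StrongDual ℝ Y), A.Nonempty → Bornology.IsBounded A → ∀ δ : ℝ, 0 < δ →
    ∃ V : Set (WeakDual ℝ Y), IsOpen V ∧
      (A ∩ StrongDual.toWeakDual ⁻¹' V).Nonempty ∧
      Metric.diam (A ∩ StrongDual.toWeakDual ⁻¹' V) < δ

/-- Asplund spaces: every continuous convex function on a nonempty open convex subset `U` is
Fréchet differentiable at each point of some dense `G_δ` subset of `U`. -/
def IsAsplundSpace (Y : Type*) [NormedAddCommGroup Y] [NormedSpace ℝ Y] : Prop :=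
  ∀ (U : Set Y) (g : Y → ℝ), U.Nonempty → IsOpen U → ConvexOn ℝ U g → ContinuousOn g U →
    ∃ G : Set Y, G ⊆ U ∧ IsGδ G ∧ U ⊆ closure G ∧ ∀ y ∈ G, DifferentiableAt ℝ g y

/-- The restriction `x|_Ω` of a continuous function on a compact space `K` to a subset `Ω`, as a
bounded continuous function on `Ω` (with the supremum norm). -/
noncomputable def restrictToSubset {K : Type*} [TopologicalSpace K] [CompactSpace K]
    (Ω : Set K) (x : C(K, ℝ)) : BoundedContinuousFunction Ω ℝ :=
  (BoundedContinuousFunction.mkOfCompact x).domRestrict Ω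

open Set Filter Topology

universe u v

/-! Testing `f` against tall positive and negative bumps at `t` gives, by weak-star compactness, a
functional `φ` in the unit ball of `Y*` with `|φ (f x) - x t| ≤ 3 * ε` for all `x`. The pairs `(t,
φ)` form a compact set over `K`. A selection `t ↦ σ t` defines `T y t = σ t y`, which is linear in
`y` with norm at most one; only continuity in `t` is missing. A minimal compact subset still
covering `K` supplies it on a dense `G_δ`, provided sets of functionals have small relatively
weak-star open pieces: norm-small under the `w^*`-PCP, small on each vector of a dense sequence when
`Y` is separable. -/

/-- Let `G` be a compact subset of `K × Z` projecting onto the compact Hausdorff space `K`. If every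
nonempty subset of `Z` meeting the range of `G` has nonempty relatively open subsets that are
`R i`-small, for each of countably many relations `R i`, then `G` has a selection which is
`R i`-continuous for all `i` at each point of a dense `G_δ` set. -/
theorem exists_generically_continuous_selection {K : Type u} {Z : Type v} {ι : Type*}
    [TopologicalSpace K] [CompactSpace K] [T2Space K] [TopologicalSpace Z] [Countable ι] {G : Set (K × Z)}
    (hG : IsCompact G) (hsurj : ∀ t, ∃ z, (t, z) ∈ G) (R : ι → Z → Z → Prop)
    (hR : ∀ i, ∀ A : Set Z, A.Nonempty → A ⊆ Prod.snd '' G →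
      ∃ V, IsOpen V ∧ (A ∩ V).Nonempty ∧ ∀ z ∈ A ∩ V, ∀ w ∈ A ∩ V, R i z w) :
    ∃ σ : K → Z, (∀ t, (t, σ t) ∈ G) ∧ ∃ Ω : Set K, IsGδ Ω ∧ Dense Ω ∧
      ∀ t ∈ Ω, ∀ i, ∀ᶠ s in 𝓝 t, R i (σ s) (σ t) := by
  have : CompactSpace G := isCompact_iff_compactSpace.mp hG
  have hcont : Continuous fun p : G ↦ p.1.1 := by fun_prop
  -- `ULift` only puts the base in the same universe as `G`.
  obtain ⟨E, hE, hEs, hmin'⟩ := exists_compact_surjective_zorn_subset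
    (X := fun p : G ↦ ULift.up.{v} p.1.1) (continuous_uliftUp.comp hcont)
    (fun ⟨t⟩ ↦ let ⟨z, hz⟩ := hsurj t; ⟨⟨(t, z), hz⟩, rfl⟩)
  have hmin : ∀ E₀ : Set E, E₀ ≠ univ → IsClosed E₀ →
      E.domRestrict (fun p : G ↦ p.1.1) '' E₀ ≠ univ := by
    intro E₀ h1 h2 h
    refine hmin' E₀ h1 h2 (eq_univ_of_forall fun ⟨t⟩ ↦ ?_)
    obtain ⟨p, hp, hpt⟩ := eq_univ_iff_forall.1 h t
    exact ⟨p, hp, congrArg ULift.up hpt⟩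
  have hE' : ∀ t, ∃ p ∈ E, p.1.1 = t := fun t ↦ by
    obtain ⟨p, hp, hpt⟩ := eq_univ_iff_forall.1 hEs ⟨t⟩
    exact ⟨p, hp, congrArg ULift.down hpt⟩
  choose e he het using hE'
  let O : ι → Set K := fun i ↦ {t | ∃ N : Set K, IsOpen N ∧ t ∈ N ∧
    ∀ p ∈ E, ∀ q ∈ E, p.1.1 ∈ N → q.1.1 ∈ N → R i p.1.2 q.1.2}
  have hOo : ∀ i, IsOpen (O i) := fun i ↦ isOpen_iff_forall_mem_open.2
    fun t ⟨N, hN, htN, h⟩ ↦ ⟨N, fun s hs ↦ ⟨N, hN, hs, h⟩, hN, htN⟩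
  have hOd : ∀ i, Dense (O i) := by
    intro i
    rw [dense_iff_inter_open]
    rintro N hN ⟨t, ht⟩
    obtain ⟨V, hV, ⟨z, ⟨p, ⟨hpE, hpN⟩, rfl⟩, hzV⟩, hsmall⟩ :=
      hR i ((fun p : G ↦ p.1.2) '' {p | p ∈ E ∧ p.1.1 ∈ N})
        ⟨_, e t, ⟨he t, by rwa [het]⟩, rfl⟩
        (by rintro _ ⟨p, -, rfl⟩; exact ⟨p.1, p.2, rfl⟩)
    let U : Set E := {p | p.1.1.1 ∈ N ∧ p.1.1.2 ∈ V}
    have hU : IsOpen U :=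
      (hN.preimage (by fun_prop : Continuous fun p : E ↦ p.1.1.1)).inter
        (hV.preimage (by fun_prop : Continuous fun p : E ↦ p.1.1.2))
    -- By minimality `Uᶜ` no longer covers `K`: over the nonempty open set of missed points, every
    -- fibre of `E` lies in `U`.
    have hne := hmin Uᶜ (compl_ne_univ.2 ⟨⟨p, hpE⟩, hpN, hzV⟩) hU.isClosed_compl
    have hcl : IsClosed (E.domRestrict (fun p : G ↦ p.1.1) '' Uᶜ) :=
      (hU.isClosed_compl.isCompact.image (hcont.comp continuous_subtype_val)).isClosed
    have hsub : ∀ q (hq : q ∈ E), q.1.1 ∈ (E.domRestrict (fun p : G ↦ p.1.1) '' Uᶜ)ᶜ →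
        q.1.1 ∈ N ∧ q.1.2 ∈ V := by
      intro q hq hqM
      by_contra hcon
      exact hqM ⟨⟨q, hq⟩, hcon, rfl⟩
    obtain ⟨m, hm⟩ := nonempty_compl.2 hne
    refine ⟨m, ?_, _, hcl.isOpen_compl, hm, fun a ha b hb haM hbM ↦ ?_⟩
    · have := (hsub (e m) (he m) (by rwa [het])).1
      rwa [het] at this
    · obtain ⟨ha1, ha2⟩ := hsub a ha haM
      obtain ⟨hb1, hb2⟩ := hsub b hb hbM
      exact hsmall _ ⟨⟨a, ⟨ha, ha1⟩, rfl⟩, ha2⟩ _ ⟨⟨b, ⟨hb, hb1⟩, rfl⟩, hb2⟩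
  refine ⟨fun t ↦ (e t).1.2, fun t ↦ ?_, ⋂ i, O i, .iInter_of_isOpen hOo,
    dense_iInter_of_isOpen hOo hOd, fun t ht i ↦ ?_⟩
  · have := (e t).2
    rwa [← Prod.mk.eta (p := (e t).1), het] at this
  · obtain ⟨N, hN, htN, h⟩ := mem_iInter.1 ht i
    filter_upwards [hN.mem_nhds htN] with s hs
    exact h _ (he s) _ (he t) (by rwa [het]) (by rwa [het])

/-! ### Approximate evaluations and the left inverse -/

section StabilityEstimate

variable {K : Type*} [TopologicalSpace K] [CompactSpace K] [T2Space K]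
  {Y : Type*} [NormedAddCommGroup Y] [NormedSpace ℝ Y]

/-- A finite set of functions on `K` can be tested against a large bump at `t` to compare the
evaluation at `t` with a functional on `Y`, up to `3 * ε + δ`. -/
theorem IsStandardEpsIsometry.exists_dual_approx_eval_finset {ε : ℝ} {f : C(K, ℝ) → Y}
    (hf : IsStandardEpsIsometry ε f) (t : K) (F : Finset C(K, ℝ)) {δ : ℝ} (hδ : 0 < δ) :
    ∃ φ : StrongDual ℝ Y, ‖φ‖ ≤ 1 ∧ ∀ x ∈ F, |φ (f x) - x t| ≤ 3 * ε + δ := by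
  let W : Set K := ⋂ x ∈ F, {s | |x s - x t| < δ}
  have hW : IsOpen W := isOpen_biInter_finset fun x _ ↦
    isOpen_lt (by fun_prop) continuous_const
  have htW : t ∈ W := by simp [W, hδ]
  obtain ⟨u, hu0, hu1, hu⟩ := exists_continuous_zero_one_of_isClosed hW.isClosed_compl
    (isClosed_singleton (x := t)) (disjoint_singleton_right.2 fun h ↦ h htW)
  have hut : u t = 1 := hu1 rfl
  -- With `2 * ‖x‖ ≤ N`, the values of `N • u - x` off `W`, where `u = 0`, cannot exceed the bound
  -- obtained near `t`.
  obtain ⟨N, hN0, hNx⟩ : ∃ N : ℝ, 0 ≤ N ∧ ∀ x ∈ F, 2 * ‖x‖ ≤ N :=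
    ⟨2 * ∑ x ∈ F, ‖x‖, by positivity, fun x hx ↦
      mul_le_mul_of_nonneg_left (Finset.single_le_sum (f := fun x ↦ ‖x‖)
        (fun _ _ ↦ norm_nonneg _) hx) two_pos.le⟩
  have hval : ∀ x : C(K, ℝ), ∀ s, |x s| ≤ ‖x‖ := fun x s ↦ x.norm_coe_le_norm s
  have hnorm : ‖N • u‖ ≤ N := by
    refine (ContinuousMap.norm_le _ hN0).2 fun s ↦ ?_
    obtain ⟨h0, h1⟩ := hu s
    simp only [ContinuousMap.smul_apply, smul_eq_mul, Real.norm_eq_abs]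
    rw [abs_of_nonneg (by positivity)]
    nlinarith
  have hdist : 2 * N ≤ ‖N • u - -(N • u)‖ := by
    have := hval (N • u - -(N • u)) t
    simp only [ContinuousMap.sub_apply, ContinuousMap.neg_apply, ContinuousMap.smul_apply,
      smul_eq_mul, hut] at this
    linarith [le_abs_self (N * 1 - -(N * 1))]
  have hbump : ∀ z : C(K, ℝ), 2 * ‖z‖ ≤ N → (∀ s ∈ W, |z s - z t| < δ) →
      ‖N • u - z‖ ≤ N - z t + δ := by
    intro z hzN hzW
    have hzt := abs_le.1 (hval z t)
    refine (ContinuousMap.norm_le _ (by linarith)).2 fun s ↦ ?_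
    obtain ⟨h0, h1⟩ := hu s
    have hzs := abs_le.1 (hval z s)
    have hl : N * u s ≤ N := mul_le_of_le_one_right hN0 h1
    have hl0 : 0 ≤ N * u s := mul_nonneg hN0 h0
    rw [ContinuousMap.sub_apply, ContinuousMap.smul_apply, smul_eq_mul, Real.norm_eq_abs]
    by_cases hs : s ∈ W
    · have := abs_lt.1 (hzW s hs)
      exact abs_le.2 ⟨by linarith, by linarith⟩
    · have : u s = 0 := hu0 hs
      rw [this, mul_zero]
      exact abs_le.2 ⟨by linarith, by linarith⟩
  -- Norming this difference costs one `ε`; comparison with `f 0 = 0` costs a second and with `f x`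
  -- a third.
  obtain ⟨φ, hφ, hφn⟩ := exists_dual_vector'' ℝ (f (N • u) - f (-(N • u)))
  have hφle : ∀ x y, φ (f x) - φ (f y) ≤ ‖x - y‖ + ε := fun x y ↦ by
    have h1 : φ (f x - f y) ≤ 1 * ‖f x - f y‖ :=
      (le_abs_self _).trans (φ.le_of_opNorm_le hφ _)
    rw [map_sub] at h1
    linarith [(abs_le.1 (hf.2 x y)).2]
  have hφn' : 2 * N - ε ≤ φ (f (N • u)) - φ (f (-(N • u))) := by
    rw [← map_sub, hφn, RCLike.ofReal_real_eq_id, id]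
    linarith [(abs_le.1 (hf.2 (N • u) (-(N • u)))).1]
  have hp := hφle (N • u) 0
  have hm := hφle 0 (-(N • u))
  rw [hf.1, map_zero, sub_zero, sub_zero] at hp
  rw [hf.1, map_zero, zero_sub, zero_sub, neg_neg] at hm
  refine ⟨φ, hφ, fun x hx ↦ ?_⟩
  have hxW : ∀ s ∈ W, |x s - x t| < δ := fun s hs ↦ by
    simpa using mem_iInter₂.1 hs x hx
  have hxN := hNx x hx
  have hup := hbump x hxN hxW
  have hlow := hbump (-x) (by rwa [norm_neg]) fun s hs ↦ by
    rw [ContinuousMap.neg_apply, ContinuousMap.neg_apply, neg_sub_neg, abs_sub_comm]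
    exact hxW s hs
  rw [ContinuousMap.neg_apply, sub_neg_eq_add, sub_neg_eq_add, add_comm (N • u)] at hlow
  have h1 := hφle (N • u) x
  have h2 := hφle x (-(N • u))
  rw [sub_neg_eq_add] at h2
  exact abs_le.2 ⟨by linarith, by linarith⟩

/-- Each evaluation functional on `C(K)` corresponds, through a standard `ε`-isometry, to a
functional of norm at most one, up to an error of `3 * ε`. -/
theorem IsStandardEpsIsometry.exists_dual_approx_eval {ε : ℝ} {f : C(K, ℝ) → Y}
    (hf : IsStandardEpsIsometry ε f) (t : K) :
    ∃ φ : WeakDual ℝ Y, ‖WeakDual.toStrongDual φ‖ ≤ 1 ∧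
      ∀ x : C(K, ℝ), |φ (f x) - x t| ≤ 3 * ε := by
  obtain ⟨φ, hφ, hφC⟩ := (WeakDual.isCompact_closedBall (𝕜 := ℝ) (0 : StrongDual ℝ Y)
    1).inter_iInter_nonempty
    (fun i : C(K, ℝ) × ℕ ↦ {φ | |φ (f i.1) - i.1 t| ≤ 3 * ε + 1 / ((i.2 : ℝ) + 1)})
    (fun i ↦ isClosed_le (((WeakDual.eval_continuous (f i.1)).sub continuous_const).abs)
      continuous_const)
    (fun u ↦ by
      classical
      obtain ⟨φ, hφ, h⟩ := hf.exists_dual_approx_eval_finset t (u.image Prod.fst)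
        (Nat.one_div_pos_of_nat (n := u.sup Prod.snd) (α := ℝ))
      refine ⟨StrongDual.toWeakDual φ, by simpa using hφ, mem_iInter₂.2 fun i hi ↦ ?_⟩
      refine (h i.1 (Finset.mem_image_of_mem _ hi)).trans ?_
      gcongr
      exact Finset.le_sup (f := Prod.snd) hi)
  refine ⟨φ, by simpa using hφ, fun x ↦ ?_⟩
  refine le_of_forall_pos_le_add fun δ hδ ↦ ?_
  obtain ⟨n, hn⟩ := exists_nat_one_div_lt hδ
  have := mem_iInter.1 hφC (x, n)
  exact (show _ ≤ _ from this).trans (by linarith)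

/-- If countably many relations have small relatively weak-star open pieces in every nonempty
subset of the dual ball, and control the values at every point, then standard `ε`-isometries of
`C(K)` have bounded linear approximate left inverses over a dense `G_δ` subset of `K`. -/
theorem IsStandardEpsIsometry.exists_approx_left_inverse {ι : Type*} [Countable ι] {ε : ℝ}
    (hε : 0 ≤ ε) {f : C(K, ℝ) → Y} (hf : IsStandardEpsIsometry ε f)
    (R : ι → WeakDual ℝ Y → WeakDual ℝ Y → Prop)
    (hR : ∀ i, ∀ A : Set (WeakDual ℝ Y), A.Nonempty →
      (∀ φ ∈ A, ‖WeakDual.toStrongDual φ‖ ≤ 1) →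
      ∃ V, IsOpen V ∧ (A ∩ V).Nonempty ∧ ∀ φ ∈ A ∩ V, ∀ ψ ∈ A ∩ V, R i φ ψ)
    (hval : ∀ (y : Y) (η : ℝ), 0 < η → ∃ i, ∀ φ ψ : WeakDual ℝ Y,
      ‖WeakDual.toStrongDual φ‖ ≤ 1 → ‖WeakDual.toStrongDual ψ‖ ≤ 1 → R i φ ψ →
        |φ y - ψ y| < η) :
    ∃ Ω : Set K, IsGδ Ω ∧ Dense Ω ∧ ∃ T : Y →L[ℝ] BoundedContinuousFunction Ω ℝ,
      ∀ x : C(K, ℝ), ‖T (f x) - restrictToSubset Ω x‖ ≤ 3 * ε := by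
  let B : Set (WeakDual ℝ Y) := WeakDual.toStrongDual ⁻¹' Metric.closedBall (0 : StrongDual ℝ Y) 1
  have hB : ∀ φ, φ ∈ B ↔ ‖WeakDual.toStrongDual φ‖ ≤ 1 := fun φ ↦ by simp [B]
  let G : Set (K × WeakDual ℝ Y) := (univ ×ˢ B) ∩ ⋂ x : C(K, ℝ), {p | |p.2 (f x) - x p.1| ≤ 3 * ε}
  have hG : IsCompact G := by
    refine (isCompact_univ.prod (WeakDual.isCompact_closedBall _ _)).inter_right
      (isClosed_iInter fun x ↦ isClosed_le ?_ continuous_const)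
    exact (((WeakDual.eval_continuous (f x)).comp continuous_snd).sub
      (x.continuous.comp continuous_fst)).abs
  obtain ⟨σ, hσ, Ω, hΩ, hΩd, hcont⟩ := exists_generically_continuous_selection hG
    (fun t ↦ by
      obtain ⟨φ, hφ, h⟩ := hf.exists_dual_approx_eval t
      exact ⟨φ, ⟨trivial, (hB φ).2 hφ⟩, mem_iInter.2 h⟩) R
    (fun i A hA hAG ↦ hR i A hA fun φ hφ ↦ by
      obtain ⟨p, hp, rfl⟩ := hAG hφ
      exact (hB _).1 hp.1.2)
  have hσB : ∀ t, ‖WeakDual.toStrongDual (σ t)‖ ≤ 1 := fun t ↦ (hB _).1 (hσ t).1.2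
  have hσf : ∀ t (x : C(K, ℝ)), |σ t (f x) - x t| ≤ 3 * ε := fun t x ↦ mem_iInter.1 (hσ t).2 x
  have hbd : ∀ t y, ‖σ t y‖ ≤ ‖y‖ := fun t y ↦ by
    simpa using (WeakDual.toStrongDual (σ t)).le_of_opNorm_le (hσB t) y
  have hc : ∀ y, Continuous fun t : Ω ↦ σ t y := fun y ↦ by
    refine continuous_iff_continuousAt.2 fun t ↦ Metric.tendsto_nhds.2 fun η hη ↦ ?_
    obtain ⟨i, hi⟩ := hval y η hη
    filter_upwards [continuous_subtype_val.continuousAt.eventually (hcont t t.2 i)] with s hs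
    exact hi _ _ (hσB s) (hσB t) hs
  let L : Y →ₗ[ℝ] BoundedContinuousFunction Ω ℝ :=
    { toFun := fun y ↦ .ofNormedAddCommGroup (fun t : Ω ↦ σ t y) (hc y) ‖y‖ fun t ↦ hbd t y
      map_add' := fun y z ↦ by ext t; exact map_add (σ t) y z
      map_smul' := fun c y ↦ by ext t; exact map_smul (σ t) c y }
  refine ⟨Ω, hΩ, hΩd, L.mkContinuous 1 fun y ↦ ?_, fun x ↦ ?_⟩
  · rw [one_mul]
    exact (BoundedContinuousFunction.norm_le (norm_nonneg _)).2 fun t ↦ hbd t y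
  · exact (BoundedContinuousFunction.norm_le (by positivity)).2 fun t ↦ hσf t x

end StabilityEstimate

/-! ### Small weak-star open pieces in the dual -/

section DualFragmentability

variable {Y : Type*} [NormedAddCommGroup Y] [NormedSpace ℝ Y]

/-- The dual of an Asplund space has the weak-star point of continuity property: the support
function of a bounded set `A` is Fréchet differentiable somewhere, and the slices of `A` determined
by a point of differentiability have small diameter. -/
theorem IsAsplundSpace.dualHasWeakStarPCP (hY : IsAsplundSpace Y) : DualHasWeakStarPCP Y := by
  intro A hA hAb δ hδ
  obtain ⟨C, hC⟩ := hAb.exists_norm_le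
  have : Nonempty A := hA.to_subtype
  let p : Y → ℝ := fun y ↦ ⨆ φ : A, φ.1 y
  have hle : ∀ φ ∈ A, ∀ y, φ y ≤ C * ‖y‖ := fun φ hφ y ↦
    (le_abs_self _).trans (φ.le_of_opNorm_le (hC φ hφ) y)
  have hbdd : ∀ y, BddAbove (range fun φ : A ↦ φ.1 y) := fun y ↦
    ⟨C * ‖y‖, by rintro _ ⟨φ, rfl⟩; exact hle φ.1 φ.2 y⟩
  have hp : ∀ φ ∈ A, ∀ y, φ y ≤ p y := fun φ hφ y ↦ le_ciSup (hbdd y) ⟨φ, hφ⟩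
  have hconv : ConvexOn ℝ univ p := by
    refine ⟨convex_univ, fun x _ y _ a b ha hb _ ↦ ciSup_le fun φ ↦ ?_⟩
    rw [map_add, map_smul, map_smul, smul_eq_mul, smul_eq_mul, smul_eq_mul, smul_eq_mul]
    exact add_le_add (mul_le_mul_of_nonneg_left (hp φ.1 φ.2 x) ha)
      (mul_le_mul_of_nonneg_left (hp φ.1 φ.2 y) hb)
  have hlip : ∀ x y, p x ≤ p y + C * dist x y := fun x y ↦ ciSup_le fun φ ↦ by
    have h1 := hle φ.1 φ.2 (x - y)
    rw [map_sub] at h1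
    rw [dist_eq_norm]
    linarith [hp φ.1 φ.2 y]
  have hcont : Continuous p := (LipschitzWith.of_le_add_mul' C hlip).continuous
  obtain ⟨S, -, -, hSd, hS⟩ := hY univ p univ_nonempty isOpen_univ hconv hcont.continuousOn
  obtain ⟨y, hy⟩ := closure_nonempty_iff.1 (univ_nonempty.mono hSd)
  obtain ⟨L, hL⟩ := hS y hy
  obtain ⟨r, hr, hball⟩ := Metric.eventually_nhds_iff_ball.1
    ((hasFDerivAt_iff_isLittleO_nhds_zero.1 hL).def (show 0 < δ / 8 by positivity))
  obtain ⟨φ₀, hφ₀⟩ := exists_lt_of_lt_ciSup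
    (show p y - δ / 8 * r < ⨆ φ : A, φ.1 y from sub_lt_self _ (by positivity))
  refine ⟨{φ | p y - δ / 8 * r < φ y}, isOpen_lt continuous_const (WeakDual.eval_continuous y),
    ⟨φ₀.1, φ₀.2, hφ₀⟩, ?_⟩
  have hnear : ∀ φ ∈ A, p y - δ / 8 * r < φ y → ‖φ - L‖ ≤ δ / 4 := by
    intro φ hφ hφy
    have hone : ∀ h ∈ Metric.ball (0 : Y) r, (φ - L) h ≤ δ / 4 * r := by
      intro h hh
      have h1 := (abs_le.1 (hball h hh)).2
      have h2 := hp φ hφ (y + h)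
      rw [map_add] at h2
      have h3 : δ / 8 * ‖h‖ ≤ δ / 8 * r :=
        mul_le_mul_of_nonneg_left (mem_ball_zero_iff.1 hh).le (by positivity)
      rw [sub_apply]
      linarith
    refine ContinuousLinearMap.opNorm_le_of_unit_norm (by positivity) fun v hv ↦ ?_
    have key : ∀ w : Y, ‖w‖ = 1 → (φ - L) w ≤ δ / 4 := by
      intro w hw
      by_contra! hcon
      have hpos : 0 < (φ - L) w := lt_trans (by positivity) hcon
      -- The ball is open, so `w` is scaled to a length just below `r`.
      obtain ⟨s, hs1, hs2⟩ := exists_between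
        (show δ / 4 * r / (φ - L) w < r by rw [div_lt_iff₀ hpos]; nlinarith)
      have hs0 : 0 < s := lt_of_le_of_lt (by positivity) hs1
      have := hone (s • w) (by
        rwa [mem_ball_zero_iff, norm_smul, hw, mul_one, Real.norm_of_nonneg hs0.le])
      rw [map_smul, smul_eq_mul] at this
      rw [div_lt_iff₀ hpos] at hs1
      linarith
    have h1 := key v hv
    have h2 := key (-v) (by rwa [norm_neg])
    rw [map_neg] at h2
    exact abs_le.2 ⟨by linarith, h1⟩
  refine (Metric.diam_le_of_forall_dist_le (by positivity : 0 ≤ δ / 2) ?_).trans_lt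
    (half_lt_self hδ)
  rintro φ ⟨hφ, hφV⟩ ψ ⟨hψ, hψV⟩
  have h1 := hnear φ hφ hφV
  have h2 := hnear ψ hψ hψV
  rw [← dist_eq_norm] at h1 h2
  linarith [dist_triangle_right φ ψ L]

theorem DualHasWeakStarPCP.exists_approx_left_inverse (hY : DualHasWeakStarPCP Y) {K : Type*}
    [TopologicalSpace K] [CompactSpace K] [T2Space K] {ε : ℝ} (hε : 0 ≤ ε) {f : C(K, ℝ) → Y}
    (hf : IsStandardEpsIsometry ε f) :
    ∃ Ω : Set K, IsGδ Ω ∧ Dense Ω ∧ ∃ T : Y →L[ℝ] BoundedContinuousFunction Ω ℝ,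
      ∀ x : C(K, ℝ), ‖T (f x) - restrictToSubset Ω x‖ ≤ 3 * ε := by
  refine hf.exists_approx_left_inverse hε
    (fun (n : ℕ) φ ψ ↦ ‖WeakDual.toStrongDual φ - WeakDual.toStrongDual ψ‖ < 1 / ((n : ℝ) + 1))
    (fun n A hA hA1 ↦ ?_) fun y η hη ↦ ?_
  · have hb : Bornology.IsBounded (StrongDual.toWeakDual ⁻¹' A) :=
      isBounded_iff_forall_norm_le.2 ⟨1, fun φ hφ ↦ hA1 _ hφ⟩
    obtain ⟨V, hV, ⟨φ, hφA, hφV⟩, hd⟩ := hY (StrongDual.toWeakDual ⁻¹' A)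
      (let ⟨φ, hφ⟩ := hA; ⟨WeakDual.toStrongDual φ, hφ⟩) hb _
      (Nat.one_div_pos_of_nat (n := n) (α := ℝ))
    refine ⟨V, hV, ⟨_, hφA, hφV⟩, fun φ hφ ψ hψ ↦ ?_⟩
    rw [← dist_eq_norm]
    exact (Metric.dist_le_diam_of_mem (hb.subset inter_subset_left)
      (show WeakDual.toStrongDual φ ∈ _ from hφ)
      (show WeakDual.toStrongDual ψ ∈ _ from hψ)).trans_lt hd
  · obtain ⟨n, hn⟩ := exists_nat_one_div_lt (show 0 < η / (‖y‖ + 1) by positivity)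
    refine ⟨n, fun φ ψ _ _ h ↦ ?_⟩
    have h1 := (WeakDual.toStrongDual φ - WeakDual.toStrongDual ψ).le_of_opNorm_le
      (h.trans hn).le y
    refine lt_of_le_of_lt h1 ?_
    rw [div_mul_eq_mul_div, div_lt_iff₀ (by positivity)]
    linarith

/-- Closeness at one vector is a weak-star open condition, so small pieces come for free; the norm
bound extends control from a dense sequence to all of `Y`. -/
theorem IsStandardEpsIsometry.exists_approx_left_inverse_of_separableSpace
    [TopologicalSpace.SeparableSpace Y] {K : Type*}
    [TopologicalSpace K] [CompactSpace K] [T2Space K] {ε : ℝ} (hε : 0 ≤ ε) {f : C(K, ℝ) → Y}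
    (hf : IsStandardEpsIsometry ε f) :
    ∃ Ω : Set K, IsGδ Ω ∧ Dense Ω ∧ ∃ T : Y →L[ℝ] BoundedContinuousFunction Ω ℝ,
      ∀ x : C(K, ℝ), ‖T (f x) - restrictToSubset Ω x‖ ≤ 3 * ε := by
  refine hf.exists_approx_left_inverse hε
    (fun (i : ℕ × ℕ) φ ψ ↦ |φ (TopologicalSpace.denseSeq Y i.1) -
      ψ (TopologicalSpace.denseSeq Y i.1)| < 1 / ((i.2 : ℝ) + 1))
    (fun i A hA _ ↦ ?_) fun y η hη ↦ ?_
  · obtain ⟨φ, hφ⟩ := hA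
    set d := TopologicalSpace.denseSeq Y i.1
    have hpos : 0 < 1 / ((i.2 : ℝ) + 1) := Nat.one_div_pos_of_nat
    refine ⟨{ψ | |ψ d - φ d| < 1 / ((i.2 : ℝ) + 1) / 2},
      isOpen_lt ((WeakDual.eval_continuous d).sub continuous_const).abs continuous_const,
      ⟨φ, hφ, ?_⟩, fun ψ hψ χ hχ ↦ ?_⟩
    · rw [mem_ofPred_eq, sub_self, abs_zero]
      positivity
    · have h1 := abs_lt.1 (show |ψ d - φ d| < _ from hψ.2)
      have h2 := abs_lt.1 (show |χ d - φ d| < _ from hχ.2)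
      exact abs_lt.2 ⟨by linarith, by linarith⟩
  · obtain ⟨m, hm⟩ := (TopologicalSpace.denseRange_denseSeq Y).exists_dist_lt y
      (show 0 < η / 3 by positivity)
    obtain ⟨n, hn⟩ := exists_nat_one_div_lt (show 0 < η / 3 by positivity)
    refine ⟨(m, n), fun φ ψ hφ hψ h ↦ ?_⟩
    set d := TopologicalSpace.denseSeq Y m
    rw [dist_eq_norm] at hm
    have hd : ∀ χ : WeakDual ℝ Y, ‖WeakDual.toStrongDual χ‖ ≤ 1 → |χ y - χ d| < η / 3 := by
      intro χ hχ
      have := (WeakDual.toStrongDual χ).le_of_opNorm_le hχ (y - d)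
      rw [map_sub, one_mul] at this
      exact lt_of_le_of_lt this hm
    have h1 := abs_lt.1 (hd φ hφ)
    have h2 := abs_lt.1 (hd ψ hψ)
    have h3 := abs_lt.1 (show |φ d - ψ d| < _ from h)
    exact abs_lt.2 ⟨by linarith, by linarith⟩

end DualFragmentability

theorem corollary2p5 {K : Type*} [TopologicalSpace K] [CompactSpace K] [T2Space K]
    {Y : Type*} [NormedAddCommGroup Y] [NormedSpace ℝ Y] [CompleteSpace Y]
    (hY : DualHasWeakStarPCP Y ∨ IsAsplundSpace Y ∨ TopologicalSpace.SeparableSpace Y)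
    (ε : ℝ) (hε : 0 ≤ ε) (f : C(K, ℝ) → Y) (hf : IsStandardEpsIsometry ε f) :
    ∃ Ω : Set K, IsGδ Ω ∧ Dense Ω ∧
      ∃ T : Y →L[ℝ] BoundedContinuousFunction Ω ℝ,
        ∀ x : C(K, ℝ), ‖T (f x) - restrictToSubset Ω x‖ ≤ 4 * ε := by
  suffices h : ∃ Ω : Set K, IsGδ Ω ∧ Dense Ω ∧ ∃ T : Y →L[ℝ] BoundedContinuousFunction Ω ℝ,
      ∀ x : C(K, ℝ), ‖T (f x) - restrictToSubset Ω x‖ ≤ 3 * ε by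
    obtain ⟨Ω, hΩ, hΩd, T, hT⟩ := h
    exact ⟨Ω, hΩ, hΩd, T, fun x ↦ (hT x).trans (by linarith)⟩
  rcases hY with hY | hY | hY
  · exact hY.exists_approx_left_inverse hε hf
  · exact hY.dualHasWeakStarPCP.exists_approx_left_inverse hε hf
  · exact hf.exists_approx_left_inverse_of_separableSpace hε
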